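/- Let $A\in\mathbb{R}^{n\times n}$, let $c\in\mathbb{R}^{1\times n}$ be a row vector, and let $k\le n$ be a natural number. Let $\mathcal{O}$ be the observability operator of $(A,c)$, i.e. the map $x_0\mapsto (cA^{t}x_0)_{t\ge 0}$, $x_0\in\mathbb{R}^n$, which is identified with the infinite matrix with $n$ columns and rows $cA^{t}$, $t=0,1,2,\dots$. Suppose that 1. $A$ is diagonalizable over $\mathbb{C}$; 2. $(A,c)$ is observable, i.e. $\mathcal{O}$ is injective; 3. $\mathcal{O}$ is strictly $k$-sign consistent, i.e. the minors of order $k$ of this matrix (the determinants of the submatrices formed by $k$ rows $t_1<\dots<t_k$ and $k$ columns $j_1<\dots<j_k$) are either all positive or all negative. Let $\lambda_1(A),\dots,\lambda_n(A)\in\mathbb{C}$ be the eigenvalues of $A$, counted with algebraic multiplicity and ordered by descending absolute value, where eigenvalues of equal absolute value are ordered by descending real part. Then $\lambda_1(A),\dots,\lambda_k(A)$ are real and positive. -/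

import Mathlib

open scoped Matrix

/-- The `k`-th multiplicative compound matrix of `X`: its entries are the `k`-minors of `X`, the
rows and columns being indexed by the strictly increasing `k`-tuples of row and column indices. -/
def Matrix.compound {ι κ R : Type*} [Preorder ι] [Preorder κ] [CommRing R]
    (X : Matrix ι κ R) (k : ℕ) : Matrix (Fin k ↪o ι) (Fin k ↪o κ) R :=
  Matrix.of fun I J => (X.submatrix I J).det

/-- Strict `k`-sign consistency: the `k`-minors are all positive or all negative. -/
def Matrix.IsStrictlySignConsistent {ι κ : Type*} [Preorder ι] [Preorder κ]
    (X : Matrix ι κ ℝ) (k : ℕ) : Prop :=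
  (∀ I J, 0 < X.compound k I J) ∨ (∀ I J, X.compound k I J < 0)

/-- The matrix, with rows `c A ^ t` for `t = 0, 1, 2, …`, of the observability operator
`x₀ ↦ (c A ^ t x₀)_{t ≥ 0}`. -/
def observabilityMatrix {n : ℕ} (A : Matrix (Fin n) (Fin n) ℝ) (c : Fin n → ℝ) :
    Matrix ℕ (Fin n) ℝ :=
  Matrix.of fun t => c ᵥ* (A ^ t)

/-- `(A, c)` is observable: the output `(c A ^ t x₀)_{t ≥ 0}` determines the state `x₀`. -/
def IsObservable {n : ℕ} (A : Matrix (Fin n) (Fin n) ℝ) (c : Fin n → ℝ) : Prop :=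
  Function.Injective fun x₀ : Fin n → ℝ => observabilityMatrix A c *ᵥ x₀

/-- `A` is diagonalizable, with complex eigenvalues allowed. -/
def IsDiagonalizableOverComplex {n : ℕ} (A : Matrix (Fin n) (Fin n) ℝ) : Prop :=
  ∃ (T : Matrix (Fin n) (Fin n) ℂ) (d : Fin n → ℂ),
    IsUnit T ∧ T⁻¹ * A.map (algebraMap ℝ ℂ) * T = Matrix.diagonal d

/-- `ev 0, …, ev (n - 1)` lists the complex eigenvalues of `A` with algebraic multiplicity, by
descending absolute value and, among equal absolute values, by descending real part. -/
structure IsOrderedEigenvalueList {n : ℕ} (A : Matrix (Fin n) (Fin n) ℝ) (ev : Fin n → ℂ) :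
    Prop where
  map_eq_roots : Finset.univ.val.map ev = (A.map (algebraMap ℝ ℂ)).charpoly.roots
  sorted : ∀ i j, i ≤ j → ‖ev j‖ < ‖ev i‖ ∨ (‖ev j‖ = ‖ev i‖ ∧ (ev j).re ≤ (ev i).re)

/-- Every real square matrix has an ordered list of eigenvalues. -/
theorem exists_isOrderedEigenvalueList {n : ℕ} (A : Matrix (Fin n) (Fin n) ℝ) :
    ∃ ev, IsOrderedEigenvalueList A ev := by
  classical
  set s := (A.map (algebraMap ℝ ℂ)).charpoly.roots with hs
  have hcard : s.card = n := by
    have h := (IsAlgClosed.splits (A.map (algebraMap ℝ ℂ)).charpoly).natDegree_eq_card_roots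
    rw [Matrix.charpoly_natDegree_eq_dim, Fintype.card_fin] at h
    exact h.symm
  obtain ⟨v, hv⟩ : ∃ v : Fin n → ℂ, Finset.univ.val.map v = s := by
    have hl : s.toList.length = n := by simpa using hcard
    refine ⟨fun i => s.toList.get (i.cast hl.symm), ?_⟩
    have : List.ofFn (fun i : Fin n => s.toList.get (i.cast hl.symm)) = s.toList := by
      apply List.ext_get
      · simp [hcard]
      · intro m h1 h2
        simp
    rw [Fin.univ_val_map, this, Multiset.coe_toList]
  let key : Fin n → (ℝ ×ₗ ℝ)ᵒᵈ := fun i => OrderDual.toDual (toLex (‖v i‖, (v i).re))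
  refine ⟨v ∘ Tuple.sort key, ?_, ?_⟩
  · rw [← hs, ← hv, ← Multiset.map_map]
    congr 1
    simp
  · intro i j hij
    have h := Tuple.monotone_sort key hij
    simp only [Function.comp_apply, key, OrderDual.toDual_le_toDual, Prod.Lex.toLex_le_toLex] at h
    exact h

open Filter Topology Finset

/-! Diagonalizing `A` by `T` factors the observability matrix as `V * U`: `V` has entries `ev j ^
t`, and `U = diagonal (c T) * T⁻¹`. Observability forces all entries of `c T` to be nonzero, so `U`
is invertible, and the eigenvalues to be distinct.

Fix the sign of the `k`-minors of `V * U` and let the largest exponent grow by `s`. The minor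
becomes an exponential sum in `s` with constant sign. Cesàro means of such a sum
(`expSum_coeff_of_nonneg`) show that the coefficient of the base `‖z‖` is nonnegative and dominates
that of every base of the same modulus, where `z = ev 0` is dominant. A suitable minor makes the
coefficient of `z` nonzero, so `‖z‖` is itself an eigenvalue, and the tie-break by real part gives
`z = ‖z‖`. The coefficient of `z` is, up to a positive power of `z`, the minor whose last power row
is replaced by `e_0`. This minor is therefore weakly of the same sign, and the argument repeats with
one power row fewer and `ev 1` dominant (`powerUnitMatrix_step`), until `k` eigenvalues are
exhausted. -/

/-! ### Cesàro means of exponential sums -/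

theorem tendsto_cesaro_pow {z : ℂ} (hz : ‖z‖ ≤ 1) :
    Tendsto (fun N : ℕ => (N : ℂ)⁻¹ * ∑ t ∈ range N, z ^ t) atTop (𝓝 (if z = 1 then 1 else 0)) := by
  split_ifs with h
  · subst h
    refine tendsto_const_nhds.congr' ?_
    filter_upwards [eventually_gt_atTop 0] with N hN
    have : (N : ℂ) ≠ 0 := by exact_mod_cast hN.ne'
    simp [this]
  · rw [tendsto_zero_iff_norm_tendsto_zero]
    have hlim : Tendsto (fun N : ℕ => (N : ℝ)⁻¹ * (2 / ‖z - 1‖)) atTop (𝓝 0) := by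
      simpa using (tendsto_inv_atTop_nhds_zero_nat (𝕜 := ℝ)).mul_const (2 / ‖z - 1‖)
    refine squeeze_zero (fun _ => norm_nonneg _) (fun N => ?_) hlim
    rw [geom_sum_eq h, norm_mul, norm_inv, Complex.norm_natCast, norm_div]
    gcongr
    calc ‖z ^ N - 1‖ ≤ ‖z ^ N‖ + ‖(1 : ℂ)‖ := norm_sub_le _ _
      _ ≤ 1 + 1 := by
        rw [norm_pow, norm_one]
        gcongr
        exact pow_le_one₀ (norm_nonneg _) hz
      _ = 2 := by norm_num

/-- The Cesàro means of an exponential sum, demodulated by `z`, single out the coefficient of `z`. -/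
theorem tendsto_cesaro_expSum {ι : Type*} [Fintype ι] {ev g : ι → ℂ} {z : ℂ} (hz : z ≠ 0)
    (hev : ∀ j, g j ≠ 0 → ‖ev j‖ ≤ ‖z‖) :
    Tendsto (fun N : ℕ => (N : ℂ)⁻¹ * ∑ t ∈ range N, (∑ j, ev j ^ t * g j) * (z⁻¹) ^ t) atTop
      (𝓝 (∑ j, if ev j = z then g j else 0)) := by
  have h : ∀ j, Tendsto (fun N : ℕ => ((N : ℂ)⁻¹ * ∑ t ∈ range N, (ev j * z⁻¹) ^ t) * g j) atTop
      (𝓝 (if ev j = z then g j else 0)) := by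
    intro j
    by_cases hg : g j = 0
    · simp [hg]
    · have h1 : ‖ev j * z⁻¹‖ ≤ 1 := by
        rw [norm_mul, norm_inv, ← div_eq_mul_inv]
        exact div_le_one_of_le₀ (hev j hg) (norm_nonneg _)
      have h2 : ev j * z⁻¹ = 1 ↔ ev j = z := by rw [← div_eq_mul_inv, div_eq_one_iff_eq hz]
      simpa only [h2, ite_mul, one_mul, zero_mul] using (tendsto_cesaro_pow h1).mul_const (g j)
  refine (tendsto_finsetSum univ fun j _ => h j).congr fun N => ?_
  rw [mul_sum]
  simp_rw [mul_pow, sum_mul, mul_sum, sum_mul]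
  rw [sum_comm]
  refine sum_congr rfl fun t _ => sum_congr rfl fun j _ => by ring

open scoped ComplexOrder in
/-- In a nonnegative exponential sum, the dominant positive base carries a nonnegative coefficient,
which bounds the coefficients of all other bases of the same absolute value. -/
theorem expSum_coeff_of_nonneg {ι : Type*} [Fintype ι] {ev g : ι → ℂ} {z : ℂ} (hz : z ≠ 0)
    (hev : ∀ j, g j ≠ 0 → ‖ev j‖ ≤ ‖z‖) (hpos : ∀ t : ℕ, 0 ≤ ∑ j, ev j ^ t * g j) :
    0 ≤ (∑ j, if ev j = (‖z‖ : ℂ) then g j else 0) ∧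
      ‖∑ j, if ev j = z then g j else 0‖ ≤ ‖∑ j, if ev j = (‖z‖ : ℂ) then g j else 0‖ := by
  have hr : (‖z‖ : ℂ) ≠ 0 := by simpa using hz
  have hlr := tendsto_cesaro_expSum hr (g := g) (ev := ev) (by simpa using hev)
  have hterm : ∀ t : ℕ, 0 ≤ (∑ j, ev j ^ t * g j) * ((‖z‖ : ℂ)⁻¹) ^ t := fun t => by
    have : (0 : ℂ) ≤ (‖z‖ : ℂ)⁻¹ := by
      rw [← Complex.ofReal_inv]; exact_mod_cast inv_nonneg.2 (norm_nonneg z)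
    exact mul_nonneg (hpos t) (pow_nonneg this t)
  refine ⟨ge_of_tendsto' hlr fun N => mul_nonneg (by simp) (sum_nonneg fun t _ => hterm t), ?_⟩
  refine le_of_tendsto_of_tendsto' (tendsto_cesaro_expSum hz hev).norm hlr.norm fun N => ?_
  rw [norm_mul, norm_mul]
  gcongr
  calc ‖∑ t ∈ range N, (∑ j, ev j ^ t * g j) * (z⁻¹) ^ t‖
      ≤ ∑ t ∈ range N, ‖(∑ j, ev j ^ t * g j) * (z⁻¹) ^ t‖ := norm_sum_le _ _
    _ = ∑ t ∈ range N, ‖(∑ j, ev j ^ t * g j) * ((‖z‖ : ℂ)⁻¹) ^ t‖ := by simp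
    _ = ‖∑ t ∈ range N, (∑ j, ev j ^ t * g j) * ((‖z‖ : ℂ)⁻¹) ^ t‖ := by
      have hn : ∀ w : ℂ, 0 ≤ w → (‖w‖ : ℂ) = w := fun w hw => RCLike.norm_of_nonneg' hw
      apply Complex.ofReal_injective
      rw [hn _ (sum_nonneg fun t _ => hterm t), Complex.ofReal_sum]
      exact sum_congr rfl fun t _ => hn _ (hterm t)

/-! ### Multilinear expansions of determinants -/

theorem det_updateRow_mul_eq_sum {m n R : Type*} [Fintype m] [DecidableEq m] [Fintype n]
    [DecidableEq n] [CommRing R] (B : Matrix m n R) (N : Matrix n m R) (p : m) (x : n → R) :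
    (B.updateRow p x * N).det = ∑ j, x j * (B.updateRow p (Pi.single j 1) * N).det := by
  simp_rw [Matrix.updateRow_mul]
  have h : x ᵥ* N = ∑ j, x j • (Pi.single j 1 ᵥ* N) := by
    ext i
    simp [Matrix.vecMul, dotProduct]
  have h2 := map_sum (Matrix.detRowAlternating.toMultilinearMap.toLinearMap (B * N) p)
    (fun j => x j • (Pi.single j (1 : R) ᵥ* N)) univ
  rw [← h] at h2
  simp only [map_smul, smul_eq_mul] at h2
  exact h2

/-- If all maximal minors of a wide matrix `M` vanish, then so does `det (M * N)`. -/
theorem det_mul_eq_zero_of_minors {k n : ℕ} {R : Type*} [CommRing R]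
    (M : Matrix (Fin k) (Fin n) R) (N : Matrix (Fin n) (Fin k) R)
    (h : ∀ J : Fin k ↪o Fin n, (M.submatrix id J).det = 0) : (M * N).det = 0 := by
  have hf : ∀ f : Fin k → Fin n, (M.submatrix id f).det = 0 := by
    intro f
    by_cases hinj : Function.Injective f
    · have hmono : StrictMono (f ∘ Tuple.sort f) :=
        (Tuple.monotone_sort f).strictMono_of_injective (hinj.comp (Equiv.injective _))
      have h1 := Matrix.det_permute' (Tuple.sort f) (M.submatrix id f)
      rw [Matrix.submatrix_submatrix] at h1
      have h2 : (M.submatrix (id ∘ id) (f ∘ Tuple.sort f)).det = 0 :=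
        h (OrderEmbedding.ofStrictMono _ hmono)
      rw [h2] at h1
      rcases Int.units_eq_one_or (Equiv.Perm.sign (Tuple.sort f)) with hs | hs <;>
        simpa [hs] using h1.symm
    · rw [Function.not_injective_iff] at hinj
      obtain ⟨a, b, hab, hne⟩ := hinj
      exact Matrix.det_zero_of_column_eq hne fun i => by simp [hab]
  rw [← Matrix.det_transpose]
  -- The columns of `M * N` are combinations of columns of `M`; expanding leaves only determinants
  -- of the kind in `hf`.
  have h1 : (M * N)ᵀ = fun i => ∑ l, N l i • Mᵀ l := by
    ext i j
    simp [Matrix.mul_apply, mul_comm]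
  have h2 := Matrix.detRowAlternating.toMultilinearMap.map_sum
    (fun (i : Fin k) (l : Fin n) => N l i • Mᵀ l)
  rw [h1]
  refine h2.trans (sum_eq_zero fun f _ => ?_)
  rw [MultilinearMap.map_smul_univ]
  have : (fun i => Mᵀ (f i)) = (M.submatrix id f)ᵀ := rfl
  rw [this]
  change _ • Matrix.det _ = 0
  rw [Matrix.det_transpose, hf, smul_zero]

/-! ### Power matrices with trailing unit rows -/

/-- The first `k - q` rows hold the powers `ev j ^ t i`; the last `q` rows are the unit vectors
`e_{q - 1}, …, e_0`. -/
def powerUnitMatrix {n k : ℕ} (hk : k ≤ n) (ev : Fin n → ℂ) (q : ℕ) (t : ℕ → ℕ) :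
    Matrix (Fin k) (Fin n) ℂ :=
  Matrix.of fun i => if i.val + q < k then fun j => ev j ^ t i else
    Pi.single (Fin.castLE hk i.rev) 1

theorem powerUnitMatrix_succ {n k : ℕ} (hk : k ≤ n) (ev : Fin n → ℂ) {q : ℕ} (hq : q < k)
    (t : ℕ → ℕ) :
    powerUnitMatrix hk ev (q + 1) t =
      (powerUnitMatrix hk ev q t).updateRow (Fin.rev ⟨q, hq⟩)
        (Pi.single (Fin.castLE hk ⟨q, hq⟩) 1) := by
  ext i j
  by_cases hi : i = Fin.rev ⟨q, hq⟩
  · subst hi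
    rw [Matrix.updateRow_self]
    have : ¬ ((Fin.rev (⟨q, hq⟩ : Fin k)).val + (q + 1) < k) := by
      simp only [Fin.val_rev]; omega
    simp only [powerUnitMatrix, Matrix.of_apply, if_neg this, Fin.rev_rev]
  · rw [Matrix.updateRow_ne hi]
    have hi' : i.val + q + 1 ≠ k := fun h => hi (by ext; simp only [Fin.val_rev]; omega)
    have : i.val + (q + 1) < k ↔ i.val + q < k := by omega
    simp only [powerUnitMatrix, Matrix.of_apply, this]

/-- Translating by `s` the exponents from row `k - q - 1` on. -/
theorem powerUnitMatrix_shift {n k : ℕ} (hk : k ≤ n) (ev : Fin n → ℂ) {q : ℕ} (hq : q < k)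
    (t : ℕ → ℕ) (s : ℕ) :
    powerUnitMatrix hk ev q (fun i => if i + q + 1 < k then t i else t i + s) =
      (powerUnitMatrix hk ev q t).updateRow (Fin.rev ⟨q, hq⟩)
        (fun j => ev j ^ (t (k - (q + 1)) + s)) := by
  ext i j
  by_cases hi : i = Fin.rev ⟨q, hq⟩
  · subst hi
    rw [Matrix.updateRow_self]
    have h1 : k - (q + 1) + q < k := by omega
    have h2 : ¬ (k - (q + 1) + q + 1 < k) := by omega
    simp [powerUnitMatrix, h1, h2]
  · rw [Matrix.updateRow_ne hi]
    have hi' : i.val + q + 1 ≠ k := fun h => hi (by ext; simp only [Fin.val_rev]; omega)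
    by_cases h : i.val + q < k
    · have h2 : i.val + q + 1 < k := by omega
      simp [powerUnitMatrix, h, h2]
    · simp [powerUnitMatrix, h]

/-- The unit vector `e_j` with `j < q` is already among the last `q` rows, so two rows coincide.
This removes the bases already treated from the exponential sum. -/
theorem det_powerUnitMatrix_updateRow_eq_zero {n k : ℕ} (hk : k ≤ n) (ev : Fin n → ℂ) {q : ℕ}
    (hq : q < k) (t : ℕ → ℕ) (N : Matrix (Fin n) (Fin k) ℂ) (j : Fin n) (hj : j.val < q) :
    ((powerUnitMatrix hk ev q t).updateRow (Fin.rev ⟨q, hq⟩) (Pi.single j 1) * N).det = 0 := by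
  set p : Fin k := Fin.rev ⟨q, hq⟩ with hp
  have hjk : j.val < k := hj.trans hq
  have hne : p ≠ Fin.rev ⟨j, hjk⟩ := by
    rw [hp, Ne, Fin.rev_inj, Fin.mk.injEq]; omega
  refine Matrix.det_zero_of_row_eq hne ?_
  rw [Matrix.updateRow_mul, Matrix.updateRow_self, Matrix.updateRow_ne hne.symm]
  have : ¬ ((Fin.rev (⟨j, hjk⟩ : Fin k)).val + q < k) := by
    simp only [Fin.val_rev]; omega
  have hrow : powerUnitMatrix hk ev q t (Fin.rev ⟨j, hjk⟩) = Pi.single j 1 := by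
    funext l
    simp only [powerUnitMatrix, Matrix.of_apply, if_neg this, Fin.rev_rev]
    rfl
  ext l
  rw [Matrix.mul_apply_eq_vecMul, hrow]

/-- In columns `q, …, k - 1` the unit rows vanish, so a left null vector yields a polynomial of
degree below `k - q` with `k - q` distinct roots. Its coefficients vanish, and the unit rows then
kill the remaining entries. -/
theorem det_powerUnitMatrix_submatrix_ne_zero {n k : ℕ} (hk : k ≤ n) {ev : Fin n → ℂ}
    (hev : Function.Injective ev) (q : ℕ) :
    ((powerUnitMatrix hk ev q id).submatrix id (Fin.castLE hk)).det ≠ 0 := by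
  intro h0
  obtain ⟨y, hy0, hy⟩ := Matrix.exists_vecMul_eq_zero_iff.2 h0
  apply hy0
  have hcol : ∀ j : Fin k, ∑ i : Fin k, y i * (if i.val + q < k then ev (Fin.castLE hk j) ^ i.val
      else if i.rev = j then 1 else 0) = 0 := by
    intro j
    refine Eq.trans (sum_congr rfl fun i _ => ?_) (congrFun hy j)
    simp only [powerUnitMatrix, Matrix.submatrix_apply, Matrix.of_apply, id]
    split_ifs with _ h2
    · rfl
    · subst h2; simp
    · rw [Pi.single_eq_of_ne]
      intro h; exact h2 (Fin.castLE_injective hk h).symm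
  -- the coefficients of the power rows form a polynomial with too many roots
  let P : Polynomial ℂ := ∑ i : Fin k, if i.val + q < k then Polynomial.monomial i.val (y i) else 0
  have hP : ∀ x, P.eval x = ∑ i : Fin k, if i.val + q < k then y i * x ^ i.val else 0 := by
    intro x
    simp only [P, Polynomial.eval_finsetSum]
    refine sum_congr rfl fun i _ => ?_
    split_ifs <;> simp
  have hroot : ∀ j : Fin k, q ≤ j.val → P.eval (ev (Fin.castLE hk j)) = 0 := by
    intro j hj
    rw [hP]
    refine Eq.trans (sum_congr rfl fun i _ => ?_) (hcol j)
    split_ifs with h1 h2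
    · rfl
    · subst h2
      simp only [Fin.val_rev] at hj
      omega
    · simp
  have hP0 : P = 0 := by
    by_cases hqk : q < k
    · refine Polynomial.eq_zero_of_natDegree_lt_card_of_eval_eq_zero P
        (f := fun j : Fin (k - q) => ev (Fin.castLE hk ⟨q + j, by omega⟩)) ?_ ?_ ?_
      · intro a b hab
        have := Fin.castLE_injective hk (hev hab)
        simp only [Fin.mk.injEq] at this
        ext; omega
      · intro j
        exact hroot _ (Nat.le_add_right _ _)
      · rw [Fintype.card_fin]
        refine lt_of_le_of_lt (Polynomial.natDegree_sum_le_of_forall_le (n := k - q - 1) _ _ ?_)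
          (by omega)
        intro i _
        split_ifs
        · exact (Polynomial.natDegree_monomial_le _).trans (by omega)
        · simp
    · exact sum_eq_zero fun i _ => if_neg (by omega)
  have hy1 : ∀ i : Fin k, i.val + q < k → y i = 0 := by
    intro i hi
    have := congrArg (fun Q => Q.coeff i.val) hP0
    simp only [P, Polynomial.finsetSum_coeff, Polynomial.coeff_zero] at this
    rw [sum_eq_single i] at this
    · simpa [hi] using this
    · intro b _ hb
      have : b.val ≠ i.val := fun h => hb (Fin.ext h)
      split_ifs <;> simp [Polynomial.coeff_monomial, this]
    · simp
  ext i
  by_cases hi : i.val + q < k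
  · exact hy1 i hi
  · have := hcol i.rev
    rw [sum_eq_single i] at this
    · simpa [hi] using this
    · intro b _ hb
      by_cases hbq : b.val + q < k
      · simp [hy1 b hbq]
      · simp [hbq, hb]
    · simp

/-- Some maximal minor of the product with an invertible matrix is nonzero. -/
theorem exists_det_powerUnitMatrix_mul_ne_zero {n k : ℕ} (hk : k ≤ n) {ev : Fin n → ℂ}
    (hev : Function.Injective ev) (q : ℕ) {U : Matrix (Fin n) (Fin n) ℂ} (hU : IsUnit U) :
    ∃ J : Fin k ↪o Fin n, (powerUnitMatrix hk ev q id * U.submatrix id J).det ≠ 0 := by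
  by_contra! h
  refine det_powerUnitMatrix_submatrix_ne_zero hk hev q ?_
  -- Multiplying by the first `k` columns of `U⁻¹` recovers the nonsingular block of the first `k`
  -- columns.
  have h1 := det_mul_eq_zero_of_minors (powerUnitMatrix hk ev q id * U)
    (U⁻¹.submatrix id (Fin.castLE hk)) (fun J => h J)
  rw [Matrix.isUnit_iff_isUnit_det] at hU
  rw [← h1]
  congr 1
  have : powerUnitMatrix hk ev q id = powerUnitMatrix hk ev q id * U * U⁻¹ := by
    rw [Matrix.mul_nonsing_inv_cancel_right _ _ hU]
  conv_lhs => rw [this]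
  rfl

/-! ### Induction on the number of unit rows -/

open scoped ComplexOrder in
/-- One step of the induction: weak sign consistency with `q` rows replaced by unit vectors makes the
`q`-th base positive, and allows one more row to be replaced. -/
theorem powerUnitMatrix_step {n k : ℕ} (hk : k ≤ n) {ev : Fin n → ℂ}
    (hinj : Function.Injective ev)
    (hsort : ∀ i j, i ≤ j → ‖ev j‖ < ‖ev i‖ ∨ (‖ev j‖ = ‖ev i‖ ∧ (ev j).re ≤ (ev i).re))
    {U : Matrix (Fin n) (Fin n) ℂ} (hU : IsUnit U) {ε : ℂ} (hε : ε ≠ 0) {q : ℕ} (hq : q < k)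
    (hne : ev (Fin.castLE hk ⟨q, hq⟩) ≠ 0)
    (hpos : ∀ t : ℕ → ℕ, StrictMono t → ∀ J : Fin k ↪o Fin n,
      0 ≤ ε * (powerUnitMatrix hk ev q t * U.submatrix id J).det) :
    (0 < ev (Fin.castLE hk ⟨q, hq⟩)) ∧ ∀ t : ℕ → ℕ, StrictMono t → ∀ J : Fin k ↪o Fin n,
      0 ≤ ε * (powerUnitMatrix hk ev (q + 1) t * U.submatrix id J).det := by
  set jq : Fin n := Fin.castLE hk ⟨q, hq⟩ with hjq
  set z := ev jq with hz
  let g : (ℕ → ℕ) → (Fin k ↪o Fin n) → Fin n → ℂ := fun t J j =>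
    ev j ^ t (k - (q + 1)) * (ε * ((powerUnitMatrix hk ev q t).updateRow (Fin.rev ⟨q, hq⟩)
      (Pi.single j 1) * U.submatrix id J).det)
  have hgle : ∀ t J j, g t J j ≠ 0 → jq ≤ j := by
    intro t J j
    contrapose!
    intro h
    simp only [g]
    rw [det_powerUnitMatrix_updateRow_eq_zero hk ev hq t _ j h, mul_zero, mul_zero]
  have hgnorm : ∀ t J j, g t J j ≠ 0 → ‖ev j‖ ≤ ‖z‖ := fun t J j h =>
    (hsort _ _ (hgle t J j h)).elim le_of_lt fun h => h.1.le
  have hgsum : ∀ t, StrictMono t → ∀ J, ∀ s : ℕ, 0 ≤ ∑ j, ev j ^ s * g t J j := by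
    intro t ht J s
    -- All exponents from row `k - q - 1` on move together, which keeps them increasing; those of
    -- the unit rows have no effect on the matrix.
    have hmono : StrictMono fun i => if i + q + 1 < k then t i else t i + s := by
      intro a b hab
      have := ht hab
      dsimp only
      split_ifs <;> omega
    have h := hpos _ hmono J
    rw [powerUnitMatrix_shift hk ev hq, det_updateRow_mul_eq_sum, mul_sum] at h
    refine h.trans_eq (sum_congr rfl fun j _ => ?_)
    simp only [g]
    ring
  have key := fun t ht J => expSum_coeff_of_nonneg hne (hgnorm t J) (hgsum t ht J)
  have hself : ∀ t J, (∑ j, if ev j = z then g t J j else 0) = g t J jq := by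
    intro t J
    rw [sum_eq_single jq]
    · simp [hz]
    · intro b _ hb
      exact if_neg fun h => hb (hinj h)
    · simp
  have hgq : ∀ t J, g t J jq = z ^ t (k - (q + 1)) *
      (ε * (powerUnitMatrix hk ev (q + 1) t * U.submatrix id J).det) := by
    intro t J
    simp only [g]
    rw [powerUnitMatrix_succ hk ev hq]
  obtain ⟨J₀, hJ₀⟩ := exists_det_powerUnitMatrix_mul_ne_zero hk hinj (q + 1) hU
  have hg0 : g id J₀ jq ≠ 0 := by
    rw [hgq]
    exact mul_ne_zero (pow_ne_zero _ hne) (mul_ne_zero hε hJ₀)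
  have hzr : z = ‖z‖ := by
    have h1 := (key id strictMono_id J₀).2
    rw [hself] at h1
    have h2 : (∑ j, if ev j = (‖z‖ : ℂ) then g id J₀ j else 0) ≠ 0 :=
      norm_pos_iff.1 ((norm_pos_iff.2 hg0).trans_le h1)
    -- The base `‖z‖` occurs at some index `j ≥ q`, so the ordering gives `‖z‖ ≤ z.re`, which forces
    -- `z = ‖z‖`.
    obtain ⟨j, -, hj⟩ := exists_ne_zero_of_sum_ne_zero h2
    rw [ite_ne_right_iff] at hj
    have hnorm : ‖ev j‖ = ‖z‖ := by rw [hj.1]; simp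
    rcases hsort _ _ (hgle _ _ _ hj.2) with h | h
    · exact absurd hnorm h.ne
    · have h3 : ‖z‖ ≤ z.re := by
        have := h.2
        rwa [hj.1, Complex.ofReal_re] at this
      have h4 : 0 ≤ z := Complex.re_eq_norm.1 (le_antisymm (Complex.re_le_norm z) h3)
      exact (RCLike.norm_of_nonneg' h4).symm
  have hzpos : 0 < z := by
    rw [hzr]
    exact_mod_cast norm_pos_iff.2 hne
  refine ⟨hzpos, fun t ht J => ?_⟩
  have h1 := (key t ht J).1
  rw [← hzr, hself, hgq] at h1
  have h2 : 0 ≤ (z ^ t (k - (q + 1)))⁻¹ := by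
    rw [hzr, ← Complex.ofReal_pow, ← Complex.ofReal_inv]
    exact_mod_cast inv_nonneg.2 (pow_nonneg (norm_nonneg z) _)
  simpa only [inv_mul_cancel_left₀ (pow_ne_zero _ hne)] using mul_nonneg h2 h1

open scoped ComplexOrder in
theorem pos_of_powerMatrix_minors_pos {n k : ℕ} (hk : k ≤ n) {ev : Fin n → ℂ}
    (hinj : Function.Injective ev)
    (hsort : ∀ i j, i ≤ j → ‖ev j‖ < ‖ev i‖ ∨ (‖ev j‖ = ‖ev i‖ ∧ (ev j).re ≤ (ev i).re))
    {U : Matrix (Fin n) (Fin n) ℂ} (hU : IsUnit U) {ε : ℂ} (hε : ε ≠ 0)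
    (hpos : ∀ t : ℕ → ℕ, StrictMono t → ∀ J : Fin k ↪o Fin n,
      0 < ε * (powerUnitMatrix hk ev 0 t * U.submatrix id J).det) (i : Fin n) (hi : i.val < k) :
    0 < ev i := by
  -- A zero eigenvalue must come last, since the next one would vanish too. This is where strict
  -- positivity of the minors is needed; the induction uses only the weak inequality.
  have hne : ∀ i : Fin n, i.val < k → ev i ≠ 0 := by
    intro i hi h0
    by_cases hin : i.val + 1 < n
    · have h1 : i ≤ ⟨i.val + 1, hin⟩ := Nat.le_succ _
      have h2 : ‖ev ⟨i.val + 1, hin⟩‖ ≤ ‖ev i‖ := (hsort _ _ h1).elim le_of_lt fun h => h.1.le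
      rw [h0, norm_zero, norm_le_zero_iff, ← h0] at h2
      have := congrArg Fin.val (hinj h2)
      simp at this
    · obtain rfl : k = n := by omega
      -- Starting the exponents at `1` avoids `0 ^ 0 = 1`, so the column of the zero eigenvalue
      -- vanishes.
      have h1 := hpos Nat.succ (fun _ _ => Nat.succ_lt_succ) (RelEmbedding.refl _)
      rw [Matrix.det_mul, Matrix.det_eq_zero_of_column_eq_zero i] at h1
      · simp at h1
      · intro l
        simp [powerUnitMatrix, h0]
  have main : ∀ q ≤ k, (∀ i : Fin n, i.val < q → 0 < ev i) ∧ ∀ t : ℕ → ℕ, StrictMono t →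
      ∀ J : Fin k ↪o Fin n, 0 ≤ ε * (powerUnitMatrix hk ev q t * U.submatrix id J).det := by
    intro q
    induction q with
    | zero => exact fun _ => ⟨fun i hi => absurd hi (Nat.not_lt_zero _),
        fun t ht J => (hpos t ht J).le⟩
    | succ q ih =>
      intro hq
      obtain ⟨h1, h2⟩ := ih (by omega)
      obtain ⟨h3, h4⟩ := powerUnitMatrix_step hk hinj hsort hU hε (q := q) hq (hne _ hq) h2
      refine ⟨fun i hi => ?_, h4⟩
      rcases Nat.lt_succ_iff_lt_or_eq.1 hi with h | h
      · exact h1 i h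
      · have : i = Fin.castLE hk ⟨q, hq⟩ := Fin.ext h
        rwa [this]
  exact (main k le_rfl).1 i hi

/-! ### Diagonalization and observability -/

theorem exists_perm_of_map_univ_eq {α β : Type*} [Fintype α] {f g : α → β}
    (h : univ.val.map f = univ.val.map g) : ∃ σ : Equiv.Perm α, ∀ a, g (σ a) = f a := by
  classical
  have hc : ∀ b, Nonempty ({a // f a = b} ≃ {a // g a = b}) := fun b => by
    rw [← Fintype.card_eq, Fintype.card_subtype, Fintype.card_subtype]
    have := congrArg (Multiset.count b) h
    rw [Multiset.count_map, Multiset.count_map] at this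
    simp only [eq_comm (a := b)] at this
    exact this
  exact ⟨Equiv.ofFiberEquiv fun b => (hc b).some, Equiv.ofFiberEquiv_map _⟩

/-- A diagonalizable matrix can be diagonalized with its eigenvalues in any prescribed order. -/
theorem exists_diagonalization_of_eigenvalueList {n : ℕ} {A : Matrix (Fin n) (Fin n) ℝ}
    (hdiag : IsDiagonalizableOverComplex A) {ev : Fin n → ℂ}
    (hev : univ.val.map ev = (A.map (algebraMap ℝ ℂ)).charpoly.roots) :
    ∃ T : Matrix (Fin n) (Fin n) ℂ, IsUnit T ∧
      A.map (algebraMap ℝ ℂ) * T = T * Matrix.diagonal ev := by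
  obtain ⟨T, d, hT, hd⟩ := hdiag
  have hT' := (Matrix.isUnit_iff_isUnit_det T).1 hT
  have hAT : A.map (algebraMap ℝ ℂ) * T = T * Matrix.diagonal d := by
    rw [← hd, Matrix.mul_assoc, Matrix.mul_nonsing_inv_cancel_left _ _ hT']
  have hroots : (A.map (algebraMap ℝ ℂ)).charpoly.roots = univ.val.map d := by
    have h := Matrix.charpoly_units_conj' hT.unit (A.map (algebraMap ℝ ℂ))
    rw [IsUnit.unit_spec, hd, Matrix.charpoly_diagonal] at h
    rw [← h, ← Polynomial.roots_multiset_prod_X_sub_C (univ.val.map d), Multiset.map_map]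
    rfl
  rw [hroots] at hev
  obtain ⟨σ, hσ⟩ := exists_perm_of_map_univ_eq hev
  refine ⟨T.submatrix id σ, ?_, ?_⟩
  · exact (Matrix.isUnit_submatrix_equiv (Equiv.refl _) σ).2 hT
  · ext i j
    have := congrFun (congrFun hAT i) (σ j)
    rw [Matrix.mul_diagonal] at this ⊢
    rw [← hσ]
    exact this

theorem observabilityMatrix_map_mul {n : ℕ} {A : Matrix (Fin n) (Fin n) ℝ} {c : Fin n → ℝ}
    {ev : Fin n → ℂ} {T : Matrix (Fin n) (Fin n) ℂ}
    (hT : A.map (algebraMap ℝ ℂ) * T = T * Matrix.diagonal ev) (t : ℕ) (j : Fin n) :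
    ((observabilityMatrix A c).map (algebraMap ℝ ℂ) * T) t j =
      ev j ^ t * ((fun i => (c i : ℂ)) ᵥ* T) j := by
  have hpow : ∀ t : ℕ, A.map (algebraMap ℝ ℂ) ^ t * T = T * Matrix.diagonal ev ^ t := fun t => by
    induction t with
    | zero => simp
    | succ t ih => rw [pow_succ, Matrix.mul_assoc, hT, ← Matrix.mul_assoc, ih, pow_succ,
        Matrix.mul_assoc]
  have hrow : (observabilityMatrix A c).map (algebraMap ℝ ℂ) t =
      (fun i => (c i : ℂ)) ᵥ* (A.map (algebraMap ℝ ℂ)) ^ t := by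
    have : (A.map (algebraMap ℝ ℂ)) ^ t = (A ^ t).map (algebraMap ℝ ℂ) :=
      (map_pow (algebraMap ℝ ℂ).mapMatrix A t).symm
    rw [this]
    funext j
    simp [observabilityMatrix, Matrix.vecMul, dotProduct]
  rw [Matrix.mul_apply_eq_vecMul, hrow, Matrix.vecMul_vecMul, hpow, ← Matrix.vecMul_vecMul,
    Matrix.diagonal_pow, Matrix.vecMul_diagonal, mul_comm, Pi.pow_apply]

theorem IsObservable.eq_zero_of_complex {n : ℕ} {A : Matrix (Fin n) (Fin n) ℝ} {c : Fin n → ℝ}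
    (hobs : IsObservable A c) {x : Fin n → ℂ}
    (hx : (observabilityMatrix A c).map (algebraMap ℝ ℂ) *ᵥ x = 0) : x = 0 := by
  have h0 : ∀ v : Fin n → ℝ, observabilityMatrix A c *ᵥ v = 0 → v = 0 := fun v hv =>
    hobs (by simpa using hv)
  have hre : (fun i => (x i).re) = 0 := h0 _ <| by
    funext t
    simpa [Matrix.mulVec, dotProduct] using congrArg Complex.re (congrFun hx t)
  have him : (fun i => (x i).im) = 0 := h0 _ <| by
    funext t
    simpa [Matrix.mulVec, dotProduct] using congrArg Complex.im (congrFun hx t)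
  funext i
  exact Complex.ext (congrFun hre i) (congrFun him i)

theorem eq_zero_of_forall_expSum_eq_zero {n : ℕ} {A : Matrix (Fin n) (Fin n) ℝ} {c : Fin n → ℝ}
    (hobs : IsObservable A c) {ev : Fin n → ℂ} {T : Matrix (Fin n) (Fin n) ℂ} (hU : IsUnit T)
    (hT : A.map (algebraMap ℝ ℂ) * T = T * Matrix.diagonal ev) {y : Fin n → ℂ}
    (hy : ∀ t : ℕ, ∑ j, ev j ^ t * ((fun i => (c i : ℂ)) ᵥ* T) j * y j = 0) : y = 0 := by
  have h : T *ᵥ y = 0 := hobs.eq_zero_of_complex <| by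
    rw [Matrix.mulVec_mulVec]
    funext t
    rw [Matrix.mulVec, dotProduct, Pi.zero_apply, ← hy t]
    refine sum_congr rfl fun j _ => ?_
    rw [observabilityMatrix_map_mul hT]
  exact Matrix.eq_zero_of_mulVec_eq_zero
    ((Matrix.isUnit_iff_isUnit_det T).1 hU).ne_zero h

theorem IsObservable.vecMul_ne_zero {n : ℕ} {A : Matrix (Fin n) (Fin n) ℝ} {c : Fin n → ℝ}
    (hobs : IsObservable A c) {ev : Fin n → ℂ} {T : Matrix (Fin n) (Fin n) ℂ} (hU : IsUnit T)
    (hT : A.map (algebraMap ℝ ℂ) * T = T * Matrix.diagonal ev) (j : Fin n) :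
    ((fun i => (c i : ℂ)) ᵥ* T) j ≠ 0 := by
  intro h
  have := eq_zero_of_forall_expSum_eq_zero hobs hU hT (y := Pi.single j 1) fun t => by
    simp [Pi.single_apply, h]
  simpa using congrFun this j

/-- A diagonalizable single-output system is observable only if its eigenvalues are distinct. -/
theorem IsObservable.injective_eigenvalues {n : ℕ} {A : Matrix (Fin n) (Fin n) ℝ} {c : Fin n → ℝ}
    (hobs : IsObservable A c) {ev : Fin n → ℂ} {T : Matrix (Fin n) (Fin n) ℂ} (hU : IsUnit T)
    (hT : A.map (algebraMap ℝ ℂ) * T = T * Matrix.diagonal ev) : Function.Injective ev := by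
  intro i j hij
  by_contra hne
  set a := (fun i => (c i : ℂ)) ᵥ* T with ha
  -- With equal eigenvalues at `i` and `j`, the outputs of these two modes are proportional, and
  -- this combination cancels them.
  have := eq_zero_of_forall_expSum_eq_zero hobs hU hT
    (y := Pi.single i (a j) - Pi.single j (a i)) fun t => by
      simp only [Pi.sub_apply, mul_sub, sum_sub_distrib, Pi.single_apply, mul_ite, mul_zero,
        sum_ite_eq', mem_univ, if_true, ← ha, hij]
      ring
  have h := congrFun this i
  simp only [Pi.sub_apply, Pi.single_eq_same, Pi.single_eq_of_ne hne, sub_zero, Pi.zero_apply] at h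
  exact hobs.vecMul_ne_zero hU hT j h

/-! ### Transfer to the observability matrix -/

theorem mainTheorem6 {n k : ℕ} (hk : k ≤ n) (A : Matrix (Fin n) (Fin n) ℝ) (c : Fin n → ℝ)
    (hdiag : IsDiagonalizableOverComplex A) (hobs : IsObservable A c)
    (hsign : (observabilityMatrix A c).IsStrictlySignConsistent k)
    (ev : Fin n → ℂ) (hev : IsOrderedEigenvalueList A ev) (i : Fin n) (hi : i.val < k) :
    ∃ x : ℝ, 0 < x ∧ ev i = (x : ℂ) := by
  obtain ⟨T, hU, hT⟩ := exists_diagonalization_of_eigenvalueList hdiag hev.map_eq_roots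
  have hTdet := (Matrix.isUnit_iff_isUnit_det T).1 hU
  set a := (fun i => (c i : ℂ)) ᵥ* T with ha
  have hW : IsUnit (Matrix.diagonal a * T⁻¹) := by
    refine IsUnit.mul ?_ ((Matrix.isUnit_nonsing_inv_iff).2 hU)
    rw [Matrix.isUnit_diagonal, Pi.isUnit_iff]
    exact fun j => (hobs.vecMul_ne_zero hU hT j).isUnit
  have hO : ∀ (t : ℕ → ℕ), (powerUnitMatrix hk ev 0 t * (Matrix.diagonal a * T⁻¹)) =
      ((observabilityMatrix A c).map (algebraMap ℝ ℂ)).submatrix (fun i : Fin k => t i) id := by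
    intro t
    have h : powerUnitMatrix hk ev 0 t * Matrix.diagonal a =
        ((observabilityMatrix A c).map (algebraMap ℝ ℂ)).submatrix (fun i : Fin k => t i) id * T := by
      ext i j
      rw [Matrix.mul_diagonal]
      refine Eq.trans ?_ (observabilityMatrix_map_mul hT (t i) j).symm
      simp [powerUnitMatrix, ha]
    rw [← Matrix.mul_assoc, h, Matrix.mul_nonsing_inv_cancel_right _ _ hTdet]
  have hminor : ∀ (t : ℕ → ℕ) (ht : StrictMono t) (J : Fin k ↪o Fin n),
      (powerUnitMatrix hk ev 0 t * (Matrix.diagonal a * T⁻¹).submatrix id J).det =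
        ((observabilityMatrix A c).compound k
          (OrderEmbedding.ofStrictMono (fun i : Fin k => t i) (ht.comp Fin.val_strictMono)) J : ℝ) := by
    intro t ht J
    have h := congrArg (fun M => (M.submatrix id J).det) (hO t)
    refine h.trans ?_
    exact (RingHom.map_det (algebraMap ℝ ℂ) _).symm
  -- The factor `ε = ±1` treats both signs of the minors at once.
  obtain ⟨ε, hε, hpos⟩ : ∃ ε : ℝ, ε ≠ 0 ∧ ∀ I J,
      0 < ε * (observabilityMatrix A c).compound k I J := by
    rcases hsign with h | h
    · exact ⟨1, one_ne_zero, fun I J => by simpa using h I J⟩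
    · exact ⟨-1, by norm_num, fun I J => by simpa using h I J⟩
  have h := pos_of_powerMatrix_minors_pos hk (hobs.injective_eigenvalues hU hT) hev.sorted hW
    (ε := ε) (by exact_mod_cast hε) (fun t ht J => by
      rw [hminor t ht J, ← Complex.ofReal_mul, Complex.zero_lt_real]
      exact hpos _ _) i hi
  rw [Complex.pos_iff] at h
  exact ⟨(ev i).re, h.1, Complex.ext rfl (by simpa using h.2.symm)⟩
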